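/- Let $\omega,\gamma,\kappa_1,\kappa_2>0$ and let $\sigma_x,\sigma_y,\sigma_z$ be the Pauli matrices. Controls $u_1,u_2$ are real functions in $L^1(0,T)$, trajectories are absolutely continuous, and equations hold for almost every $t\in[0,T]$. A qubit with two coherent controls is completely controllable in the interior of the Bloch ball and on the set of non-pure density matrices, already without incoherent control: (i) Consider the Bloch system on $\mathbb R^3$ $$\dot{\mathbf r}=\omega f_0(\mathbf r)+2\kappa_1u_1(t)\,f_x(\mathbf r)+2\kappa_2u_2(t)\,f_y(\mathbf r),$$ where, for $\mathbf r=(x,y,z)$, $$f_0(\mathbf r)=\Bigl(-y-\tfrac{\gamma}{2\omega}x,\ x-\tfrac{\gamma}{2\omega}y,\ \tfrac{\gamma}{\omega}(1-z)\Bigr),\qquad f_x(\mathbf r)=(0,-z,y),\qquad f_y(\mathbf r)=(z,0,-x).$$ For any two interior points $\mathbf r^0,\mathbf r^1$ of the Bloch ball $\{|\mathbf r|\le1\}$ there are a finite time $T\ge0$, controls $u_1,u_2\in L^1(0,T)$ and a trajectory with $\mathbf r(0)=\mathbf r^0$ and $\mathbf r(T)=\mathbf r^1$. (ii) Consider the master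 equation on $2\times2$ complex matrices $$\dot\rho=-i\bigl[\omega\sigma_z+\kappa_1u_1(t)\sigma_x+\kappa_2u_2(t)\sigma_y,\ \rho\bigr]+\gamma(n(t)+1)\Bigl(\sigma^-\rho\sigma^+-\tfrac12\{\sigma^+\sigma^-,\rho\}\Bigr)+\gamma n(t)\Bigl(\sigma^+\rho\sigma^--\tfrac12\{\sigma^-\sigma^+,\rho\}\Bigr)$$ with incoherent control $n\equiv0$, where $\sigma^+=\begin{pmatrix}0&0\\1&0\end{pmatrix}$ and $\sigma^-=\begin{pmatrix}0&1\\0&0\end{pmatrix}$. For any two density matrices $\rho^0,\rho^1$ ($\rho\ge0$, $\operatorname{Tr}\rho=1$) that are not pure ($\rho^2\ne\rho$) there are a finite time $T\ge0$, controls $u_1,u_2\in L^1(0,T)$ and a trajectory with $\rho(0)=\rho^0$ and $\rho(T)=\rho^1$. (The two normalizations of the frequency differ: under $\rho=\frac12(I+x\sigma_x+y\sigma_y+z\sigma_z)$ the master equation in (ii) becomes the system in (i) with rotation rate $2\omega$ around the $z$ axis, while the relaxation terms and the control terms agree.) -/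

import Mathlib

open MeasureTheory Matrix
open scoped ComplexOrder

noncomputable section

namespace QubitControl

/-! ### Bloch vectors -/

/-- The Bloch ball, as the closed Euclidean unit ball of `ℝ³`; coordinates `0, 1, 2` are
`x, y, z`. -/
def blochBall : Set (EuclideanSpace ℝ (Fin 3)) := Metric.closedBall 0 1

/-- The uncontrolled vector field `f₀`: rotation around the `z` axis, plus `γ / ω` times the
relaxation towards `(0, 0, 1)`. -/
def f₀ (ω γ : ℝ) (r : EuclideanSpace ℝ (Fin 3)) : EuclideanSpace ℝ (Fin 3) :=
  !₂[-(r 1) - γ / ω * (1 / 2 * r 0), r 0 - γ / ω * (1 / 2 * r 1), -(γ / ω * r 2) + γ / ω]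

/-- The generator of rotations around the `x` axis. -/
def fx (r : EuclideanSpace ℝ (Fin 3)) : EuclideanSpace ℝ (Fin 3) := !₂[0, -(r 2), r 1]

/-- The generator of rotations around the `y` axis. -/
def fy (r : EuclideanSpace ℝ (Fin 3)) : EuclideanSpace ℝ (Fin 3) := !₂[r 2, 0, -(r 0)]

/-- The right-hand side of the Bloch system with two coherent controls (values `u₁`, `u₂`) and
without incoherent control. -/
def blochField (ω γ κ₁ κ₂ u₁ u₂ : ℝ) (r : EuclideanSpace ℝ (Fin 3)) :
    EuclideanSpace ℝ (Fin 3) :=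
  ω • f₀ ω γ r + (2 * κ₁ * u₁) • fx r + (2 * κ₂ * u₂) • fy r

/-- `r` is a (Carathéodory) trajectory on `[0, T]` of the Bloch system for the controls
`u₁, u₂`, in the equivalent integral form.  The integrand is integrable as soon as `u₁`, `u₂` are
integrable on `[0, T]` and `r` is continuous there. -/
def IsBlochTrajectory (ω γ κ₁ κ₂ T : ℝ) (u₁ u₂ : ℝ → ℝ) (r : ℝ → EuclideanSpace ℝ (Fin 3)) :
    Prop :=
  ContinuousOn r (Set.Icc 0 T) ∧
    ∀ t ∈ Set.Icc 0 T, r t = r 0 + ∫ s in (0 : ℝ)..t, blochField ω γ κ₁ κ₂ (u₁ s) (u₂ s) (r s)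

/-- The points exactly reachable from `r₀` in finite time by integrable coherent controls. -/
def blochReachableSet (ω γ κ₁ κ₂ : ℝ) (r₀ : EuclideanSpace ℝ (Fin 3)) :
    Set (EuclideanSpace ℝ (Fin 3)) :=
  {r₁ | ∃ T : ℝ, 0 ≤ T ∧ ∃ u₁ u₂ : ℝ → ℝ,
    IntervalIntegrable u₁ volume 0 T ∧ IntervalIntegrable u₂ volume 0 T ∧
    ∃ r : ℝ → EuclideanSpace ℝ (Fin 3),
      IsBlochTrajectory ω γ κ₁ κ₂ T u₁ u₂ r ∧ r 0 = r₀ ∧ r T = r₁}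

/-! ### Density matrices -/

/-- The Pauli matrix `σ_x`. -/
def σx : Matrix (Fin 2) (Fin 2) ℂ := !![0, 1; 1, 0]

/-- The Pauli matrix `σ_y`. -/
def σy : Matrix (Fin 2) (Fin 2) ℂ := !![0, -Complex.I; Complex.I, 0]

/-- The Pauli matrix `σ_z`. -/
def σz : Matrix (Fin 2) (Fin 2) ℂ := !![1, 0; 0, -1]

/-- The raising matrix `|1⟩⟨0|`; the ground state `|0⟩` is the first basis vector. -/
def σp : Matrix (Fin 2) (Fin 2) ℂ := !![0, 0; 1, 0]

/-- The lowering matrix `|0⟩⟨1|`. -/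
def σm : Matrix (Fin 2) (Fin 2) ℂ := !![0, 1; 0, 0]

/-- Density matrices of a qubit. -/
def IsDensityMatrix (ρ : Matrix (Fin 2) (Fin 2) ℂ) : Prop := ρ.PosSemidef ∧ ρ.trace = 1

/-- Pure states: the density matrices that are (necessarily rank one) projections. -/
def IsPureState (ρ : Matrix (Fin 2) (Fin 2) ℂ) : Prop := IsDensityMatrix ρ ∧ ρ * ρ = ρ

/-- The Hamiltonian with two coherent controls. -/
def hamiltonian (ω κ₁ κ₂ u₁ u₂ : ℝ) : Matrix (Fin 2) (Fin 2) ℂ :=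
  (ω : ℂ) • σz + ((κ₁ * u₁ : ℝ) : ℂ) • σx + ((κ₂ * u₂ : ℝ) : ℂ) • σy

/-- The dissipator `L ρ Lᴴ - ½ {Lᴴ L, ρ}`. -/
def dissipator (L ρ : Matrix (Fin 2) (Fin 2) ℂ) : Matrix (Fin 2) (Fin 2) ℂ :=
  L * ρ * Lᴴ - (1 / 2 : ℂ) • (Lᴴ * L * ρ + ρ * (Lᴴ * L))

/-- The right-hand side of the master equation with coherent controls `u₁`, `u₂` and incoherent
control `n` (note that `σmᴴ = σp` and `σpᴴ = σm`). -/
def masterField (ω γ κ₁ κ₂ u₁ u₂ n : ℝ) (ρ : Matrix (Fin 2) (Fin 2) ℂ) :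
    Matrix (Fin 2) (Fin 2) ℂ :=
  (-Complex.I) • (hamiltonian ω κ₁ κ₂ u₁ u₂ * ρ - ρ * hamiltonian ω κ₁ κ₂ u₁ u₂)
    + ((γ * (n + 1) : ℝ) : ℂ) • dissipator σm ρ
    + ((γ * n : ℝ) : ℂ) • dissipator σp ρ

/-- `ρ` is a (Carathéodory) trajectory on `[0, T]` of the master equation for the given controls,
in integral form and entry by entry. -/
def IsMasterTrajectory (ω γ κ₁ κ₂ T : ℝ) (u₁ u₂ n : ℝ → ℝ)
    (ρ : ℝ → Matrix (Fin 2) (Fin 2) ℂ) : Prop :=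
  ContinuousOn ρ (Set.Icc 0 T) ∧
    ∀ t ∈ Set.Icc 0 T, ∀ i j, ρ t i j =
      ρ 0 i j + ∫ s in (0 : ℝ)..t, masterField ω γ κ₁ κ₂ (u₁ s) (u₂ s) (n s) (ρ s) i j

/-- The matrices exactly reachable from `ρ₀` in finite time by integrable coherent controls, the
incoherent control being identically zero. -/
def masterReachableSet (ω γ κ₁ κ₂ : ℝ) (ρ₀ : Matrix (Fin 2) (Fin 2) ℂ) :
    Set (Matrix (Fin 2) (Fin 2) ℂ) :=
  {ρ₁ | ∃ T : ℝ, 0 ≤ T ∧ ∃ u₁ u₂ : ℝ → ℝ,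
    IntervalIntegrable u₁ volume 0 T ∧ IntervalIntegrable u₂ volume 0 T ∧
    ∃ ρ : ℝ → Matrix (Fin 2) (Fin 2) ℂ,
      IsMasterTrajectory ω γ κ₁ κ₂ T u₁ u₂ (fun _ => 0) ρ ∧ ρ 0 = ρ₀ ∧ ρ T = ρ₁}

end QubitControl

end

/-!
The relaxation drives every Bloch vector on the `z` axis upwards, towards the ground state
`(0, 0, 1)`. In spherical coordinates, coherent controls whose angular velocity is orthogonal to
the meridian plane, which itself turns at the rate `ω`, move the polar angle arbitrarily fast,
whereas the radius obeys `R' = γ (cos θ - (1 + cos² θ) R / 2)` and hardly changes in a short time.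
So every polar angle is reached at almost the same radius. To move down the axis, rise to near the
ground state, turn over to near the south pole and rise again. To hit a target with given radius
and angles exactly, solve the radius equation backwards in time from the target to the `z` axis.

The Bloch representation carries the Bloch system with rotation rate `2 ω` to the master equation,
and a density matrix with Bloch vector `r` has determinant `(1 - ‖r‖²) / 4`, which vanishes exactly
for pure states.
-/

namespace QubitControl

section LinearODE

variable {E : Type*} [NormedAddCommGroup E] [NormedSpace ℝ E]

theorem exists_hasDerivAt_sub_smul [CompleteSpace E] {p : ℝ → E} {q : ℝ → ℝ} (hp : Continuous p)
    (hq : Continuous q) (t₀ : ℝ) (x₀ : E) :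
    ∃ x : ℝ → E, x t₀ = x₀ ∧ ∀ t, HasDerivAt x (p t - q t • x t) t := by
  let A : ℝ → ℝ := fun t => ∫ s in t₀..t, q s
  have hA (t : ℝ) : HasDerivAt A (q t) t := (hq.integral_hasStrictDerivAt t₀ t).hasDerivAt
  have hAc : Continuous A := continuous_iff_continuousAt.2 fun t => (hA t).continuousAt
  let B : ℝ → E := fun t => ∫ s in t₀..t, Real.exp (A s) • p s
  have hB (t : ℝ) : HasDerivAt B (Real.exp (A t) • p t) t :=
    (Continuous.integral_hasStrictDerivAt (by fun_prop) t₀ t).hasDerivAt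
  refine ⟨fun t => Real.exp (-A t) • (x₀ + B t), by simp [A, B], fun t => ?_⟩
  refine ((hA t).fun_neg.exp.smul ((hB t).const_add x₀)).congr_deriv ?_
  rw [smul_smul, ← Real.exp_add, neg_add_cancel, Real.exp_zero, one_smul, smul_smul,
    mul_neg, neg_smul, mul_comm, sub_eq_add_neg]

/-- Grönwall's inequality on both sides of `t₀` at once, by running it along the segment from `t₀`
to `t`. -/
theorem norm_sub_le_of_norm_deriv_le {f f' : ℝ → E} {K : ℝ} (hf : ∀ t, HasDerivAt f (f' t) t)
    (hK : ∀ t, ‖f' t‖ ≤ K * (1 + ‖f t‖)) (t₀ t : ℝ) :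
    ‖f t - f t₀‖ ≤ (1 + ‖f t₀‖) * (Real.exp (K * |t - t₀|) - 1) := by
  let g : ℝ → E := fun s => f (t₀ + s * (t - t₀)) - f t₀
  let L : ℝ := K * |t - t₀|
  have hg (s : ℝ) : HasDerivAt g ((t - t₀) • f' (t₀ + s * (t - t₀))) s :=
    ((hf _).scomp s (((hasDerivAt_id s).mul_const (t - t₀)).const_add t₀)).sub_const (f t₀)
      |>.congr_deriv (by rw [one_mul, id])
  have hg_bound (s : ℝ) :
      ‖(t - t₀) • f' (t₀ + s * (t - t₀))‖ ≤ L * ‖g s‖ + L * (1 + ‖f t₀‖) := by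
    have hK₀ : 0 ≤ K := nonneg_of_mul_nonneg_left ((norm_nonneg _).trans (hK t)) (by positivity)
    have hnorm : ‖f (t₀ + s * (t - t₀))‖ ≤ ‖f t₀‖ + ‖g s‖ := norm_le_norm_add_norm_sub' _ _
    calc ‖(t - t₀) • f' (t₀ + s * (t - t₀))‖
        ≤ |t - t₀| * (K * (1 + (‖f t₀‖ + ‖g s‖))) := by
          rw [norm_smul, Real.norm_eq_abs]
          gcongr
          exact (hK _).trans (by gcongr)
      _ = L * ‖g s‖ + L * (1 + ‖f t₀‖) := by ring
  have hgronwall : ‖g 1‖ ≤ gronwallBound 0 L (L * (1 + ‖f t₀‖)) (1 - 0) :=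
    norm_le_gronwallBound_of_norm_deriv_right_le (a := 0) (b := 1)
      (fun s _ => (hg s).continuousAt.continuousWithinAt)
      (fun s _ => (hg s).hasDerivWithinAt) (by simp [g]) (fun s _ => hg_bound s) 1 (by simp)
  have hg_one : g 1 = f t - f t₀ := by simp [g]
  rw [hg_one] at hgronwall
  refine hgronwall.trans_eq ?_
  change _ = (1 + ‖f t₀‖) * (Real.exp L - 1)
  rcases eq_or_ne L 0 with hL | hL
  · simp [hL, gronwallBound_K0]
  · simp [gronwallBound_of_K_ne_0 hL, mul_div_cancel_left₀ _ hL]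

end LinearODE

section Concatenation

variable {α : Type*}

/-- The concatenation of two functions of time: `f` up to time `T`, and then `g` with its clock
restarted at time `T`. It pastes together controls as well as trajectories. -/
noncomputable def concat (T : ℝ) (f g : ℝ → α) (t : ℝ) : α := if t ≤ T then f t else g (t - T)

theorem concat_of_le {T t : ℝ} (f g : ℝ → α) (ht : t ≤ T) : concat T f g t = f t := if_pos ht

theorem concat_of_lt {T t : ℝ} (f g : ℝ → α) (ht : T < t) : concat T f g t = g (t - T) :=
  if_neg ht.not_ge

theorem concat_of_ge {T t : ℝ} {f g : ℝ → α} (hfg : f T = g 0) (ht : T ≤ t) :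
    concat T f g t = g (t - T) := by
  rcases ht.eq_or_lt with rfl | ht
  · rw [concat_of_le f g le_rfl, hfg, sub_self]
  · exact concat_of_lt f g ht

theorem continuousOn_concat [TopologicalSpace α] {T S : ℝ} {f g : ℝ → α} (hT : 0 ≤ T) (hS : 0 ≤ S)
    (hf : ContinuousOn f (Set.Icc 0 T)) (hg : ContinuousOn g (Set.Icc 0 S)) (hfg : f T = g 0) :
    ContinuousOn (concat T f g) (Set.Icc 0 (T + S)) := by
  have hg' : ContinuousOn (fun t => g (t - T)) (Set.Icc T (T + S)) :=
    hg.comp (by fun_prop) fun t ht => ⟨by linarith [ht.1], by linarith [ht.2]⟩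
  rw [← Set.Icc_union_Icc_eq_Icc hT (by linarith : T ≤ T + S)]
  exact (hf.congr fun t ht => concat_of_le f g ht.2).union_of_isClosed
    (hg'.congr fun t ht => concat_of_ge hfg ht.1) isClosed_Icc isClosed_Icc

variable {E : Type*} [NormedAddCommGroup E] {f g : ℝ → E} {T S : ℝ}

theorem intervalIntegrable_concat_left (g : ℝ → E) (hT : 0 ≤ T)
    (hf : IntervalIntegrable f volume 0 T) : IntervalIntegrable (concat T f g) volume 0 T := by
  refine hf.congr fun t ht => ?_
  rw [Set.uIoc_of_le hT] at ht
  exact (concat_of_le f g ht.2).symm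

theorem intervalIntegrable_concat_right (f : ℝ → E) (hS : 0 ≤ S)
    (hg : IntervalIntegrable g volume 0 S) :
    IntervalIntegrable (concat T f g) volume T (T + S) := by
  have hshift : IntervalIntegrable (fun t => g (t - T)) volume T (T + S) := by
    simpa [add_comm] using hg.comp_sub_right T
  refine hshift.congr fun t ht => ?_
  rw [Set.uIoc_of_le (by linarith)] at ht
  exact (concat_of_lt f g ht.1).symm

theorem intervalIntegrable_concat (hT : 0 ≤ T) (hS : 0 ≤ S)
    (hf : IntervalIntegrable f volume 0 T) (hg : IntervalIntegrable g volume 0 S) :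
    IntervalIntegrable (concat T f g) volume 0 (T + S) :=
  (intervalIntegrable_concat_left g hT hf).trans (intervalIntegrable_concat_right f hS hg)

variable [NormedSpace ℝ E]

theorem integral_concat_of_le {t : ℝ} (f g : ℝ → E) (ht₀ : 0 ≤ t) (ht : t ≤ T) :
    ∫ s in (0 : ℝ)..t, concat T f g s = ∫ s in (0 : ℝ)..t, f s := by
  refine intervalIntegral.integral_congr fun s hs => ?_
  rw [Set.uIcc_of_le ht₀] at hs
  exact concat_of_le f g (hs.2.trans ht)

theorem integral_concat (hT : 0 ≤ T) (hS : 0 ≤ S) (hf : IntervalIntegrable f volume 0 T)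
    (hg : IntervalIntegrable g volume 0 S) :
    ∫ s in (0 : ℝ)..(T + S), concat T f g s =
      (∫ s in (0 : ℝ)..T, f s) + ∫ s in (0 : ℝ)..S, g s := by
  have hright : ∫ s in T..(T + S), concat T f g s = ∫ s in T..(T + S), g (s - T) := by
    refine intervalIntegral.integral_congr_ae (.of_forall fun s hs => ?_)
    rw [Set.uIoc_of_le (by linarith)] at hs
    exact concat_of_lt f g hs.1
  rw [← intervalIntegral.integral_add_adjacent_intervals
    (intervalIntegrable_concat_left g hT hf) (intervalIntegrable_concat_right f hS hg),
    integral_concat_of_le f g hT le_rfl, hright, intervalIntegral.integral_comp_sub_right,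
    sub_self, add_sub_cancel_left]

end Concatenation

section Reachability

variable {ω γ κ₁ κ₂ T : ℝ}

theorem continuous_f₀ : Continuous (f₀ ω γ) := by unfold f₀; fun_prop

theorem continuous_fx : Continuous fx := by unfold fx; fun_prop

theorem continuous_fy : Continuous fy := by unfold fy; fun_prop

theorem intervalIntegrable_blochField {a b : ℝ} {u₁ u₂ : ℝ → ℝ}
    {r : ℝ → EuclideanSpace ℝ (Fin 3)} (hu₁ : IntervalIntegrable u₁ volume a b)
    (hu₂ : IntervalIntegrable u₂ volume a b) (hr : ContinuousOn r (Set.uIcc a b)) :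
    IntervalIntegrable (fun s => blochField ω γ κ₁ κ₂ (u₁ s) (u₂ s) (r s)) volume a b := by
  refine ((ContinuousOn.intervalIntegrable ?_).add ?_).add ?_
  · exact (continuous_f₀.comp_continuousOn hr).const_smul ω
  · exact (hu₁.const_mul (2 * κ₁)).smul_continuousOn (continuous_fx.comp_continuousOn hr)
  · exact (hu₂.const_mul (2 * κ₂)).smul_continuousOn (continuous_fy.comp_continuousOn hr)

theorem mem_blochReachableSet_of_hasDerivAt (hT : 0 ≤ T) {u₁ u₂ : ℝ → ℝ}
    {r : ℝ → EuclideanSpace ℝ (Fin 3)} (hu₁ : ContinuousOn u₁ (Set.Icc 0 T))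
    (hu₂ : ContinuousOn u₂ (Set.Icc 0 T))
    (hr : ∀ t ∈ Set.Icc 0 T, HasDerivAt r (blochField ω γ κ₁ κ₂ (u₁ t) (u₂ t) (r t)) t) :
    r T ∈ blochReachableSet ω γ κ₁ κ₂ (r 0) := by
  have hrc : ContinuousOn r (Set.Icc 0 T) := fun t ht => (hr t ht).continuousAt.continuousWithinAt
  rw [← Set.uIcc_of_le hT] at hu₁ hu₂
  refine ⟨T, hT, u₁, u₂, hu₁.intervalIntegrable, hu₂.intervalIntegrable, r,
    ⟨hrc, fun t ht => ?_⟩, rfl, rfl⟩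
  have hsub : Set.uIcc 0 t ⊆ Set.uIcc 0 T := Set.uIcc_subset_uIcc_left (Set.Icc_subset_uIcc ht)
  have hr' : ∀ s ∈ Set.uIcc 0 t, HasDerivAt r (blochField ω γ κ₁ κ₂ (u₁ s) (u₂ s) (r s)) s :=
    fun s hs => hr s (Set.uIcc_of_le hT ▸ hsub hs)
  rw [intervalIntegral.integral_eq_sub_of_hasDerivAt hr' (intervalIntegrable_blochField
    (hu₁.mono hsub).intervalIntegrable (hu₂.mono hsub).intervalIntegrable
    fun s hs => (hr' s hs).continuousAt.continuousWithinAt), add_sub_cancel]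

theorem mem_blochReachableSet_trans {a b c : EuclideanSpace ℝ (Fin 3)}
    (hab : b ∈ blochReachableSet ω γ κ₁ κ₂ a) (hbc : c ∈ blochReachableSet ω γ κ₁ κ₂ b) :
    c ∈ blochReachableSet ω γ κ₁ κ₂ a := by
  obtain ⟨T, hT, u₁, u₂, hu₁, hu₂, r, ⟨hrc, hr⟩, rfl, rT⟩ := hab
  obtain ⟨S, hS, v₁, v₂, hv₁, hv₂, q, ⟨hqc, hq⟩, q0, rfl⟩ := hbc
  have hrq : r T = q 0 := rT.trans q0.symm
  have hfield : (fun s => blochField ω γ κ₁ κ₂ (concat T u₁ v₁ s) (concat T u₂ v₂ s)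
      (concat T r q s)) = concat T (fun s => blochField ω γ κ₁ κ₂ (u₁ s) (u₂ s) (r s))
        (fun s => blochField ω γ κ₁ κ₂ (v₁ s) (v₂ s) (q s)) := by
    funext s
    simp only [concat]
    split_ifs <;> rfl
  refine ⟨T + S, add_nonneg hT hS, concat T u₁ v₁, concat T u₂ v₂,
    intervalIntegrable_concat hT hS hu₁ hv₁, intervalIntegrable_concat hT hS hu₂ hv₂,
    concat T r q, ⟨continuousOn_concat hT hS hrc hqc hrq, fun t ht => ?_⟩,
    concat_of_le r q hT, ?_⟩
  · rw [hfield, concat_of_le r q hT]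
    rcases le_total t T with htT | hTt
    · rw [concat_of_le r q htT, integral_concat_of_le _ _ ht.1 htT, hr t ⟨ht.1, htT⟩]
    obtain ⟨s, rfl⟩ := exists_add_of_le hTt
    have hs : s ∈ Set.Icc 0 S := ⟨by linarith, by linarith [ht.2]⟩
    have hsub : Set.uIcc 0 s ⊆ Set.uIcc 0 S :=
      Set.uIcc_subset_uIcc_left (Set.Icc_subset_uIcc hs)
    rw [integral_concat hT hs.1
      (intervalIntegrable_blochField hu₁ hu₂ (by rwa [Set.uIcc_of_le hT]))
      ((intervalIntegrable_blochField hv₁ hv₂ (by rwa [Set.uIcc_of_le hS])).mono_set hsub),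
      ← add_assoc, ← hr T ⟨hT, le_rfl⟩, hrq, ← hq s hs, concat_of_ge hrq hTt,
      add_sub_cancel_left]
  · rw [concat_of_ge hrq (by linarith), add_sub_cancel_left]

end Reachability

section BlochVectorField

/-- The cross product of `ℝ³` as a bilinear map on `EuclideanSpace ℝ (Fin 3)`: the coherent part
of the dynamics is `r ↦ cross a r` for an angular velocity `a`. -/
noncomputable def cross : EuclideanSpace ℝ (Fin 3) →ₗ[ℝ] EuclideanSpace ℝ (Fin 3) →ₗ[ℝ]
    EuclideanSpace ℝ (Fin 3) :=
  let e := WithLp.linearEquiv 2 ℝ (Fin 3 → ℝ)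
  (crossProduct.compl₁₂ e.toLinearMap e.toLinearMap).compr₂ e.symm.toLinearMap

theorem cross_eq (a r : EuclideanSpace ℝ (Fin 3)) :
    cross a r = !₂[a 1 * r 2 - a 2 * r 1, a 2 * r 0 - a 0 * r 2, a 0 * r 1 - a 1 * r 0] :=
  congrArg (WithLp.toLp 2) (cross_apply a.ofLp r.ofLp)

/-- The relaxation of a Bloch vector towards the ground state `(0, 0, 1)`, at unit rate. -/
noncomputable def relaxation (r : EuclideanSpace ℝ (Fin 3)) : EuclideanSpace ℝ (Fin 3) :=
  !₂[-(r 0 / 2), -(r 1 / 2), 1 - r 2]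

theorem blochField_eq_cross_add_relaxation {ω : ℝ} (hω : ω ≠ 0) (γ κ₁ κ₂ u₁ u₂ : ℝ)
    (r : EuclideanSpace ℝ (Fin 3)) : blochField ω γ κ₁ κ₂ u₁ u₂ r =
      cross !₂[2 * κ₁ * u₁, 2 * κ₂ * u₂, ω] r + γ • relaxation r := by
  have hωγ : ω * (γ / ω) = γ := mul_div_cancel₀ _ hω
  ext i
  fin_cases i <;> simp only [blochField, f₀, fx, fy, cross_eq, relaxation, PiLp.add_apply,
    PiLp.smul_apply, smul_eq_mul, Fin.zero_eta, Fin.mk_one, Fin.reduceFinMk, cons_val]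
  · linear_combination (-(r 0 / 2)) * hωγ
  · linear_combination (-(r 1 / 2)) * hωγ
  · linear_combination (1 - r 2) * hωγ

end BlochVectorField

section SphericalCoordinates

/-- The ground state `(0, 0, 1)` of the Bloch ball. -/
noncomputable def northPole : EuclideanSpace ℝ (Fin 3) := !₂[0, 0, 1]

/-- The unit vector with polar angle `θ` and azimuth `φ`. The vectors `radialUnit θ φ`,
`polarUnit θ φ` and `azimuthalUnit φ` form the orthonormal frame of spherical coordinates. -/
noncomputable def radialUnit (θ φ : ℝ) : EuclideanSpace ℝ (Fin 3) :=
  !₂[Real.sin θ * Real.cos φ, Real.sin θ * Real.sin φ, Real.cos θ]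

/-- The unit vector of the spherical frame in the direction of growing polar angle. -/
noncomputable def polarUnit (θ φ : ℝ) : EuclideanSpace ℝ (Fin 3) :=
  !₂[Real.cos θ * Real.cos φ, Real.cos θ * Real.sin φ, -Real.sin θ]

/-- The unit vector of the spherical frame in the direction of growing azimuth. -/
noncomputable def azimuthalUnit (φ : ℝ) : EuclideanSpace ℝ (Fin 3) :=
  !₂[-Real.sin φ, Real.cos φ, 0]

theorem radialUnit_zero (φ : ℝ) : radialUnit 0 φ = northPole := by
  simp [radialUnit, northPole]

theorem radialUnit_pi (φ : ℝ) : radialUnit Real.pi φ = -northPole := by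
  ext i
  fin_cases i <;> simp [radialUnit, northPole]

theorem exists_sqrt_mul_cos_sin (x y : ℝ) :
    ∃ φ, √(x ^ 2 + y ^ 2) * Real.cos φ = x ∧ √(x ^ 2 + y ^ 2) * Real.sin φ = y := by
  have hnorm : √(x ^ 2 + y ^ 2) = ‖(⟨x, y⟩ : ℂ)‖ := by
    rw [Complex.norm_def, Complex.normSq_mk, sq, sq]
  rw [hnorm]
  exact ⟨Complex.arg ⟨x, y⟩, Complex.norm_mul_cos_arg _, Complex.norm_mul_sin_arg _⟩

theorem norm_sq_eq_sum_three (r : EuclideanSpace ℝ (Fin 3)) :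
    ‖r‖ ^ 2 = r 0 ^ 2 + r 1 ^ 2 + r 2 ^ 2 := by
  rw [EuclideanSpace.real_norm_sq_eq, Fin.sum_univ_three]

theorem exists_eq_norm_smul_radialUnit (r : EuclideanSpace ℝ (Fin 3)) :
    ∃ θ φ, r = ‖r‖ • radialUnit θ φ := by
  obtain ⟨φ, hx, hy⟩ := exists_sqrt_mul_cos_sin (r 0) (r 1)
  obtain ⟨θ, hz, hρ⟩ := exists_sqrt_mul_cos_sin (r 2) √(r 0 ^ 2 + r 1 ^ 2)
  have hnorm : √(r 2 ^ 2 + √(r 0 ^ 2 + r 1 ^ 2) ^ 2) = ‖r‖ := by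
    rw [Real.sq_sqrt (by positivity), add_comm, ← norm_sq_eq_sum_three,
      Real.sqrt_sq (norm_nonneg r)]
  rw [hnorm] at hz hρ
  refine ⟨θ, φ, ?_⟩
  ext i
  fin_cases i <;> simp [radialUnit, ← mul_assoc, hx, hy, hz, hρ]

theorem hasDerivAt_radialUnit {θ φ : ℝ → ℝ} {θ' φ' t : ℝ} (hθ : HasDerivAt θ θ' t)
    (hφ : HasDerivAt φ φ' t) :
    HasDerivAt (fun s => radialUnit (θ s) (φ s))
      (θ' • polarUnit (θ t) (φ t) + (φ' * Real.sin (θ t)) • azimuthalUnit (φ t)) t := by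
  refine (PiLp.hasFDerivAt_toLp (𝕜 := ℝ) 2 _).comp_hasDerivAt t
    (f' := (θ' • polarUnit (θ t) (φ t) + (φ' * Real.sin (θ t)) • azimuthalUnit (φ t)).ofLp)
    (hasDerivAt_pi.2 fun i => ?_)
  fin_cases i
  · exact (hθ.sin.mul hφ.cos).congr_deriv (by simp [polarUnit, azimuthalUnit]; ring)
  · exact (hθ.sin.mul hφ.sin).congr_deriv (by simp [polarUnit, azimuthalUnit]; ring)
  · exact hθ.cos.congr_deriv (by simp [polarUnit, azimuthalUnit]; ring)

theorem cross_azimuthalUnit_radialUnit (θ φ : ℝ) :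
    cross (azimuthalUnit φ) (radialUnit θ φ) = polarUnit θ φ := by
  rw [cross_eq]
  ext i
  fin_cases i <;> simp only [azimuthalUnit, radialUnit, polarUnit, Fin.zero_eta, Fin.mk_one,
    Fin.reduceFinMk, cons_val]
  · ring
  · ring
  · linear_combination (-Real.sin θ) * Real.sin_sq_add_cos_sq φ

theorem cross_northPole_radialUnit (θ φ : ℝ) :
    cross northPole (radialUnit θ φ) = Real.sin θ • azimuthalUnit φ := by
  rw [cross_eq]
  ext i
  fin_cases i <;> simp [northPole, azimuthalUnit, radialUnit]

/-- The radial component of the relaxation at the point `R • radialUnit θ φ`. -/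
noncomputable def radialRate (θ R : ℝ) : ℝ := Real.cos θ - (1 + Real.cos θ ^ 2) / 2 * R

/-- The polar component of the relaxation at the point `R • radialUnit θ φ`. -/
noncomputable def polarRate (θ R : ℝ) : ℝ := (R * Real.cos θ / 2 - 1) * Real.sin θ

theorem relaxation_smul_radialUnit (R θ φ : ℝ) :
    relaxation (R • radialUnit θ φ) =
      radialRate θ R • radialUnit θ φ + polarRate θ R • polarUnit θ φ := by
  ext i
  fin_cases i <;> simp only [relaxation, radialUnit, polarUnit, radialRate, polarRate,
    PiLp.add_apply, PiLp.smul_apply, smul_eq_mul, Fin.zero_eta, Fin.mk_one, Fin.reduceFinMk,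
    cons_val]
  · ring
  · ring
  · linear_combination (R * Real.cos θ / 2 - 1) * Real.sin_sq_add_cos_sq θ

theorem relaxation_smul_northPole (z : ℝ) :
    relaxation (z • northPole) = (1 - z) • northPole := by
  ext i
  fin_cases i <;> simp [relaxation, northPole]

theorem abs_radialRate_le (θ R : ℝ) : |radialRate θ R| ≤ 1 + |R| := by
  have hcoeff : |(1 + Real.cos θ ^ 2) / 2| ≤ 1 := by
    rw [abs_of_nonneg (by positivity)]
    linarith [Real.cos_sq_le_one θ]
  calc |radialRate θ R|
      ≤ |Real.cos θ| + |(1 + Real.cos θ ^ 2) / 2| * |R| := by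
        rw [← abs_mul]; exact abs_sub _ _
    _ ≤ 1 + 1 * |R| := by gcongr; exact Real.abs_cos_le_one θ
    _ = 1 + |R| := by rw [one_mul]

end SphericalCoordinates

section Steering

variable {ω γ κ₁ κ₂ : ℝ}

/-- Coherent controls whose angular velocity `v • azimuthalUnit φ` is orthogonal to the meridian
plane of azimuth `φ` turn that plane only at the drift rate `ω`. -/
theorem blochField_smul_radialUnit (hω : ω ≠ 0) (hκ₁ : κ₁ ≠ 0) (hκ₂ : κ₂ ≠ 0) (v R θ φ : ℝ) :
    blochField ω γ κ₁ κ₂ (-(v * Real.sin φ) / (2 * κ₁)) (v * Real.cos φ / (2 * κ₂))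
        (R • radialUnit θ φ) =
      (γ * radialRate θ R) • radialUnit θ φ + (R * v + γ * polarRate θ R) • polarUnit θ φ +
        (R * (ω * Real.sin θ)) • azimuthalUnit φ := by
  have hangular : (!₂[2 * κ₁ * (-(v * Real.sin φ) / (2 * κ₁)),
      2 * κ₂ * (v * Real.cos φ / (2 * κ₂)), ω] : EuclideanSpace ℝ (Fin 3)) =
        v • azimuthalUnit φ + ω • northPole := by
    rw [mul_div_cancel₀ _ (by positivity), mul_div_cancel₀ _ (by positivity)]
    ext i
    fin_cases i <;> simp [azimuthalUnit, northPole]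
  rw [blochField_eq_cross_add_relaxation hω, hangular, relaxation_smul_radialUnit, map_smul,
    map_add, map_smul, map_smul, LinearMap.add_apply, LinearMap.smul_apply, LinearMap.smul_apply,
    cross_azimuthalUnit_radialUnit, cross_northPole_radialUnit]
  module

theorem blochField_zero_controls_smul_northPole (hω : ω ≠ 0) (z : ℝ) :
    blochField ω γ κ₁ κ₂ 0 0 (z • northPole) = (γ * (1 - z)) • northPole := by
  have hcross : cross !₂[2 * κ₁ * 0, 2 * κ₂ * 0, ω] (z • northPole) = 0 := by
    rw [cross_eq]
    ext i
    fin_cases i <;> simp [northPole]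
  rw [blochField_eq_cross_add_relaxation hω, hcross, zero_add, relaxation_smul_northPole,
    smul_smul]

theorem smul_radialUnit_mem_blochReachableSet (hω : ω ≠ 0) (hκ₁ : κ₁ ≠ 0) (hκ₂ : κ₂ ≠ 0)
    {T : ℝ} (hT : 0 ≤ T) {θ θ' R : ℝ → ℝ} (hθ : ∀ t ∈ Set.Icc 0 T, HasDerivAt θ (θ' t) t)
    (hθ' : ContinuousOn θ' (Set.Icc 0 T))
    (hR : ∀ t ∈ Set.Icc 0 T, HasDerivAt R (γ * radialRate (θ t) (R t)) t)
    (hR₀ : ∀ t ∈ Set.Icc 0 T, R t ≠ 0) (φ₀ : ℝ) :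
    R T • radialUnit (θ T) (φ₀ + ω * T) ∈
      blochReachableSet ω γ κ₁ κ₂ (R 0 • radialUnit (θ 0) φ₀) := by
  have hθc : ContinuousOn θ (Set.Icc 0 T) := fun t ht => (hθ t ht).continuousAt.continuousWithinAt
  have hRc : ContinuousOn R (Set.Icc 0 T) := fun t ht => (hR t ht).continuousAt.continuousWithinAt
  let φ : ℝ → ℝ := fun t => φ₀ + ω * t
  let v : ℝ → ℝ := fun t => θ' t - γ * polarRate (θ t) (R t) / R t
  have hvc : ContinuousOn v (Set.Icc 0 T) := by
    unfold v polarRate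
    fun_prop (disch := assumption)
  have hreach : R T • radialUnit (θ T) (φ T) ∈
      blochReachableSet ω γ κ₁ κ₂ (R 0 • radialUnit (θ 0) (φ 0)) := by
    refine mem_blochReachableSet_of_hasDerivAt (r := fun t => R t • radialUnit (θ t) (φ t)) hT
      (u₁ := fun t => -(v t * Real.sin (φ t)) / (2 * κ₁))
      (u₂ := fun t => v t * Real.cos (φ t) / (2 * κ₂)) (by fun_prop) (by fun_prop) fun t ht => ?_
    have hφ : HasDerivAt φ ω t :=
      (((hasDerivAt_id t).const_mul ω).const_add φ₀).congr_deriv (mul_one ω)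
    have hv : R t * v t + γ * polarRate (θ t) (R t) = R t * θ' t := by
      rw [mul_sub, mul_div_cancel₀ _ (hR₀ t ht), sub_add_cancel]
    refine ((hR t ht).smul (hasDerivAt_radialUnit (hθ t ht) hφ)).congr_deriv ?_
    rw [blochField_smul_radialUnit hω hκ₁ hκ₂, hv]
    module
  simpa only [φ, mul_zero, add_zero] using hreach

/-- The rate of change of `R` is bounded independently of `θ`, so `T` does not depend on how fast
the polar angle moves. -/
theorem exists_pos_forall_exists_radius (γ R₀ : ℝ) {δ : ℝ} (hδ : 0 < δ) :
    ∃ T > 0, ∀ θ : ℝ → ℝ, Continuous θ → ∀ t₀ ∈ Set.Icc 0 T, ∃ R : ℝ → ℝ, R t₀ = R₀ ∧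
      (∀ t, HasDerivAt R (γ * radialRate (θ t) (R t)) t) ∧
      ∀ t ∈ Set.Icc 0 T, |R t - R₀| < δ := by
  have hsmall : ∀ᶠ T in nhds (0 : ℝ), (1 + |R₀|) * (Real.exp (|γ| * T) - 1) < δ :=
    ContinuousAt.eventually_lt (by fun_prop) continuousAt_const (by simpa using hδ)
  obtain ⟨T, hTδ, hT⟩ := ((hsmall.filter_mono nhdsWithin_le_nhds).and
    (self_mem_nhdsWithin (s := Set.Ioi (0 : ℝ)))).exists
  refine ⟨T, hT, fun θ hθ t₀ ht₀ => ?_⟩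
  obtain ⟨R, hRt₀, hR⟩ := exists_hasDerivAt_sub_smul (p := fun t => γ * Real.cos (θ t))
    (q := fun t => γ * ((1 + Real.cos (θ t) ^ 2) / 2)) (by fun_prop) (by fun_prop) t₀ R₀
  have hR' (t : ℝ) : HasDerivAt R (γ * radialRate (θ t) (R t)) t :=
    (hR t).congr_deriv (by rw [radialRate, smul_eq_mul]; ring)
  have hbound (t : ℝ) : ‖γ * radialRate (θ t) (R t)‖ ≤ |γ| * (1 + ‖R t‖) := by
    rw [norm_mul, Real.norm_eq_abs, Real.norm_eq_abs, Real.norm_eq_abs]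
    gcongr
    exact abs_radialRate_le _ _
  refine ⟨R, hRt₀, hR', fun t ht => ?_⟩
  have hdist : |t - t₀| ≤ T :=
    abs_sub_le_iff.2 ⟨by linarith [ht.2, ht₀.1], by linarith [ht.1, ht₀.2]⟩
  calc |R t - R₀| ≤ (1 + |R₀|) * (Real.exp (|γ| * |t - t₀|) - 1) :=
        hRt₀ ▸ norm_sub_le_of_norm_deriv_le hR' hbound t₀ t
    _ ≤ (1 + |R₀|) * (Real.exp (|γ| * T) - 1) := by gcongr
    _ < δ := hTδ

theorem exists_rotation_radius_near (hω : ω ≠ 0) (hκ₁ : κ₁ ≠ 0) (hκ₂ : κ₂ ≠ 0) {R₀ δ : ℝ}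
    (hδ : 0 < δ) (hδR₀ : δ ≤ R₀) (θ₀ θ₁ : ℝ) :
    ∃ T ≥ 0, ∀ t₀ ∈ Set.Icc 0 T, ∃ R : ℝ → ℝ, R t₀ = R₀ ∧
      (∀ t ∈ Set.Icc 0 T, |R t - R₀| < δ) ∧
      ∀ φ₀, R T • radialUnit θ₁ (φ₀ + ω * T) ∈
        blochReachableSet ω γ κ₁ κ₂ (R 0 • radialUnit θ₀ φ₀) := by
  obtain ⟨T, hT, hradius⟩ := exists_pos_forall_exists_radius γ R₀ hδ
  let θ : ℝ → ℝ := fun t => θ₀ + (θ₁ - θ₀) / T * t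
  have hθ (t : ℝ) : HasDerivAt θ ((θ₁ - θ₀) / T) t :=
    (((hasDerivAt_id t).const_mul _).const_add θ₀).congr_deriv (mul_one _)
  have hθ0 : θ 0 = θ₀ := by simp [θ]
  have hθT : θ T = θ₁ := by simp [θ, div_mul_cancel₀ _ hT.ne']
  refine ⟨T, hT.le, fun t₀ ht₀ => ?_⟩
  obtain ⟨R, hRt₀, hR, hRδ⟩ := hradius θ (by fun_prop) t₀ ht₀
  have hR₀ : ∀ t ∈ Set.Icc 0 T, R t ≠ 0 := fun t ht => by linarith [(abs_lt.1 (hRδ t ht)).1]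
  refine ⟨R, hRt₀, hRδ, fun φ₀ => ?_⟩
  simpa only [hθ0, hθT] using smul_radialUnit_mem_blochReachableSet hω hκ₁ hκ₂ hT.le
    (fun t _ => hθ t) continuousOn_const (fun t _ => hR t) hR₀ φ₀

theorem exists_reachable_polar_angle (hω : ω ≠ 0) (hκ₁ : κ₁ ≠ 0) (hκ₂ : κ₂ ≠ 0) {R₀ δ : ℝ}
    (hδ : 0 < δ) (hδR₀ : δ ≤ R₀) (θ₀ θ₁ φ₀ : ℝ) :
    ∃ R φ, |R - R₀| < δ ∧
      R • radialUnit θ₁ φ ∈ blochReachableSet ω γ κ₁ κ₂ (R₀ • radialUnit θ₀ φ₀) := by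
  obtain ⟨T, hT, hrot⟩ := exists_rotation_radius_near hω hκ₁ hκ₂ hδ hδR₀ θ₀ θ₁
  obtain ⟨R, rfl, hRδ, hreach⟩ := hrot 0 ⟨le_rfl, hT⟩
  exact ⟨R T, φ₀ + ω * T, hRδ T ⟨hT, le_rfl⟩, hreach φ₀⟩

theorem exists_polar_angle_reaching (hω : ω ≠ 0) (hκ₁ : κ₁ ≠ 0) (hκ₂ : κ₂ ≠ 0) {R₁ δ : ℝ}
    (hδ : 0 < δ) (hδR₁ : δ ≤ R₁) (θ₀ θ₁ φ₁ : ℝ) :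
    ∃ R φ, |R - R₁| < δ ∧
      R₁ • radialUnit θ₁ φ₁ ∈ blochReachableSet ω γ κ₁ κ₂ (R • radialUnit θ₀ φ) := by
  obtain ⟨T, hT, hrot⟩ := exists_rotation_radius_near hω hκ₁ hκ₂ hδ hδR₁ θ₀ θ₁
  obtain ⟨R, rfl, hRδ, hreach⟩ := hrot T ⟨hT, le_rfl⟩
  refine ⟨R 0, φ₁ - ω * T, hRδ 0 ⟨le_rfl, hT⟩, ?_⟩
  simpa only [sub_add_cancel] using hreach (φ₁ - ω * T)

theorem smul_northPole_mem_blochReachableSet_of_le (hω : ω ≠ 0) (hγ : 0 < γ) {a b : ℝ}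
    (hab : a ≤ b) (hb : b < 1) :
    b • northPole ∈ blochReachableSet ω γ κ₁ κ₂ (a • northPole) := by
  have hb' : 0 < 1 - b := sub_pos.2 hb
  have ha' : 0 < 1 - a := by linarith
  let z : ℝ → ℝ := fun t => 1 - (1 - a) * Real.exp (-(γ * t))
  let T : ℝ := Real.log ((1 - a) / (1 - b)) / γ
  have hT : 0 ≤ T := div_nonneg (Real.log_nonneg ((one_le_div hb').2 (by linarith))) hγ.le
  have hz (t : ℝ) : HasDerivAt z (γ * (1 - z t)) t :=
    ((((hasDerivAt_id t).const_mul γ).fun_neg.exp.const_mul (1 - a)).const_sub 1).congr_deriv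
      (by simp only [z, id]; ring)
  have hz0 : z 0 = a := by simp [z]
  have hzT : z T = b := by
    have hγT : γ * T = Real.log ((1 - a) / (1 - b)) := mul_div_cancel₀ _ hγ.ne'
    simp only [z]
    rw [hγT, Real.exp_neg, Real.exp_log (by positivity), inv_div, mul_div_cancel₀ _ ha'.ne',
      sub_sub_cancel]
  rw [← hz0, ← hzT]
  refine mem_blochReachableSet_of_hasDerivAt (u₁ := fun _ => 0) (u₂ := fun _ => 0)
    (r := fun t => z t • northPole) hT continuousOn_const continuousOn_const fun t _ => ?_
  rw [blochField_zero_controls_smul_northPole hω]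
  exact (hz t).smul_const northPole

/-- The drift only moves upwards: to descend, rise to a height `c` with `-b < c`, turn over to a
point below `b`, and rise again. -/
theorem smul_northPole_mem_blochReachableSet (hω : ω ≠ 0) (hγ : 0 < γ) (hκ₁ : κ₁ ≠ 0)
    (hκ₂ : κ₂ ≠ 0) {a b : ℝ} (ha : a < 1) (hb : |b| < 1) :
    b • northPole ∈ blochReachableSet ω γ κ₁ κ₂ (a • northPole) := by
  obtain ⟨hb₁, hb₂⟩ := abs_lt.1 hb
  obtain ⟨c, hc, hc₁⟩ := exists_between (max_lt (max_lt ha one_pos) (neg_lt.1 hb₁))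
  obtain ⟨⟨hac, hc₀⟩, hbc⟩ : (a < c ∧ 0 < c) ∧ -b < c := by simpa only [max_lt_iff] using hc
  obtain ⟨R, φ, hR, hturn⟩ := exists_reachable_polar_angle (γ := γ) hω hκ₁ hκ₂
    (lt_min hc₀ (by linarith : 0 < c + b)) (min_le_left _ _) 0 Real.pi 0
  rw [radialUnit_zero, radialUnit_pi, smul_neg, ← neg_smul] at hturn
  have hRb : -R ≤ b := by linarith [(abs_lt.1 (hR.trans_le (min_le_right _ _))).1]
  exact mem_blochReachableSet_trans (smul_northPole_mem_blochReachableSet_of_le hω hγ hac.le hc₁)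
    (mem_blochReachableSet_trans hturn (smul_northPole_mem_blochReachableSet_of_le hω hγ hRb hb₂))

theorem exists_smul_northPole_mem_blochReachableSet (hω : ω ≠ 0) (hγ : 0 < γ) (hκ₁ : κ₁ ≠ 0)
    (hκ₂ : κ₂ ≠ 0) (r : EuclideanSpace ℝ (Fin 3)) :
    ∃ a : ℝ, a ≤ 0 ∧ a • northPole ∈ blochReachableSet ω γ κ₁ κ₂ r := by
  rcases eq_or_ne r 0 with rfl | hr
  · refine ⟨0, le_rfl, ?_⟩
    simpa using smul_northPole_mem_blochReachableSet_of_le hω hγ (le_refl (0 : ℝ)) one_pos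
  obtain ⟨θ, φ, hrθφ⟩ := exists_eq_norm_smul_radialUnit r
  obtain ⟨R, φ', hR, hreach⟩ := exists_reachable_polar_angle (γ := γ) hω hκ₁ hκ₂
    (norm_pos_iff.2 hr) le_rfl θ Real.pi φ
  rw [← hrθφ, radialUnit_pi, smul_neg, ← neg_smul] at hreach
  exact ⟨-R, by linarith [(abs_lt.1 hR).1], hreach⟩

theorem exists_mem_blochReachableSet_smul_northPole (hω : ω ≠ 0) (hγ : 0 < γ) (hκ₁ : κ₁ ≠ 0)
    (hκ₂ : κ₂ ≠ 0) {r : EuclideanSpace ℝ (Fin 3)} (hr : ‖r‖ < 1) :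
    ∃ b : ℝ, |b| < 1 ∧ r ∈ blochReachableSet ω γ κ₁ κ₂ (b • northPole) := by
  rcases eq_or_ne r 0 with rfl | hr₀
  · refine ⟨0, by simp, ?_⟩
    simpa using smul_northPole_mem_blochReachableSet_of_le hω hγ (le_refl (0 : ℝ)) one_pos
  obtain ⟨θ, φ, hrθφ⟩ := exists_eq_norm_smul_radialUnit r
  obtain ⟨R, φ', hR, hreach⟩ := exists_polar_angle_reaching (γ := γ) hω hκ₁ hκ₂
    (lt_min (norm_pos_iff.2 hr₀) (sub_pos.2 hr)) (min_le_left _ _) 0 θ φ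
  rw [← hrθφ, radialUnit_zero] at hreach
  have hlower := (abs_lt.1 (hR.trans_le (min_le_left _ _))).1
  have hupper := (abs_lt.1 (hR.trans_le (min_le_right _ _))).2
  exact ⟨R, abs_lt.2 ⟨by linarith, by linarith⟩, hreach⟩

theorem mem_blochReachableSet_of_norm_lt_one (hω : ω ≠ 0) (hγ : 0 < γ) (hκ₁ : κ₁ ≠ 0)
    (hκ₂ : κ₂ ≠ 0) (r₀ : EuclideanSpace ℝ (Fin 3)) {r₁ : EuclideanSpace ℝ (Fin 3)}
    (hr₁ : ‖r₁‖ < 1) : r₁ ∈ blochReachableSet ω γ κ₁ κ₂ r₀ := by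
  obtain ⟨a, ha, hfirst⟩ := exists_smul_northPole_mem_blochReachableSet hω hγ hκ₁ hκ₂ r₀
  obtain ⟨b, hb, hlast⟩ := exists_mem_blochReachableSet_smul_northPole hω hγ hκ₁ hκ₂ hr₁
  have haxis := smul_northPole_mem_blochReachableSet hω hγ hκ₁ hκ₂ (ha.trans_lt one_pos) hb
  exact mem_blochReachableSet_trans hfirst (mem_blochReachableSet_trans haxis hlast)

end Steering

section BlochRepresentation

/-- The traceless Hermitian matrix `(x σx + y σy + z σz) / 2`: Hamiltonians and velocities of
density matrices have this form. -/
noncomputable def pauliMatrix : EuclideanSpace ℝ (Fin 3) →ₗ[ℝ] Matrix (Fin 2) (Fin 2) ℂ where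
  toFun r := (1 / 2 : ℂ) • ((r 0 : ℂ) • σx + (r 1 : ℂ) • σy + (r 2 : ℂ) • σz)
  map_add' r q := by
    simp only [PiLp.add_apply, Complex.ofReal_add]
    module
  map_smul' c r := by
    simp only [PiLp.smul_apply, smul_eq_mul, Complex.ofReal_mul, RingHom.id_apply,
      ← Complex.coe_smul c]
    module

theorem pauliMatrix_eq (r : EuclideanSpace ℝ (Fin 3)) : pauliMatrix r =
    !![(r 2 : ℂ) / 2, (r 0 - Complex.I * r 1) / 2;
      (r 0 + Complex.I * r 1) / 2, -(r 2 : ℂ) / 2] := by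
  ext i j
  fin_cases i <;> fin_cases j <;> simp [pauliMatrix, σx, σy, σz] <;> ring

/-- The trace-one Hermitian matrix with Bloch vector `r`. -/
noncomputable def blochMatrix (r : EuclideanSpace ℝ (Fin 3)) : Matrix (Fin 2) (Fin 2) ℂ :=
  (1 / 2 : ℂ) • 1 + pauliMatrix r

theorem blochMatrix_eq (r : EuclideanSpace ℝ (Fin 3)) : blochMatrix r =
    !![(1 + r 2 : ℂ) / 2, (r 0 - Complex.I * r 1) / 2;
      (r 0 + Complex.I * r 1) / 2, (1 - r 2 : ℂ) / 2] := by
  rw [blochMatrix, pauliMatrix_eq, Matrix.one_fin_two]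
  ext i j
  fin_cases i <;> fin_cases j <;> simp <;> ring

theorem commutator_pauliMatrix_blochMatrix (a r : EuclideanSpace ℝ (Fin 3)) :
    (-Complex.I) • (pauliMatrix a * blochMatrix r - blochMatrix r * pauliMatrix a) =
      pauliMatrix (cross a r) := by
  have hI := Complex.I_sq
  rw [cross_eq, pauliMatrix_eq, pauliMatrix_eq, blochMatrix_eq]
  ext i j
  fin_cases i <;> fin_cases j <;> simp only [Matrix.mul_fin_two, Matrix.sub_apply,
    Matrix.smul_apply, of_apply, smul_eq_mul, Complex.ofReal_sub, Complex.ofReal_mul,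
    Fin.zero_eta, Fin.mk_one, cons_val', cons_val]
  · linear_combination (-(a 0 * r 1 - a 1 * r 0) / 2) * hI
  · linear_combination ((a 2 * r 1 - a 1 * r 2) / 2) * hI
  · linear_combination ((a 2 * r 1 - a 1 * r 2) / 2) * hI
  · linear_combination ((a 0 * r 1 - a 1 * r 0) / 2) * hI

theorem dissipator_σm_blochMatrix (r : EuclideanSpace ℝ (Fin 3)) :
    dissipator σm (blochMatrix r) = pauliMatrix (relaxation r) := by
  have hσm : σmᴴ = σp := by
    ext i j
    fin_cases i <;> fin_cases j <;> simp [σm, σp]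
  rw [dissipator, hσm, blochMatrix_eq, pauliMatrix_eq]
  ext i j
  fin_cases i <;> fin_cases j <;> simp [σm, σp, relaxation] <;> ring

theorem hamiltonian_eq_pauliMatrix (ω κ₁ κ₂ u₁ u₂ : ℝ) :
    hamiltonian ω κ₁ κ₂ u₁ u₂ = pauliMatrix !₂[2 * κ₁ * u₁, 2 * κ₂ * u₂, 2 * ω] := by
  change _ = (1 / 2 : ℂ) • (((2 * κ₁ * u₁ : ℝ) : ℂ) • σx + ((2 * κ₂ * u₂ : ℝ) : ℂ) • σy +
    ((2 * ω : ℝ) : ℂ) • σz)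
  rw [hamiltonian]
  push_cast
  module

theorem masterField_blochMatrix {ω : ℝ} (hω : ω ≠ 0) (γ κ₁ κ₂ u₁ u₂ : ℝ)
    (r : EuclideanSpace ℝ (Fin 3)) : masterField ω γ κ₁ κ₂ u₁ u₂ 0 (blochMatrix r) =
      pauliMatrix (blochField (2 * ω) γ κ₁ κ₂ u₁ u₂ r) := by
  rw [masterField, hamiltonian_eq_pauliMatrix, commutator_pauliMatrix_blochMatrix,
    dissipator_σm_blochMatrix, blochField_eq_cross_add_relaxation (mul_ne_zero two_ne_zero hω),
    map_add, map_smul, zero_add, mul_one, mul_zero, Complex.ofReal_zero, zero_smul, add_zero,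
    Complex.coe_smul]

theorem continuous_blochMatrix : Continuous blochMatrix :=
  continuous_const.add pauliMatrix.continuous_of_finiteDimensional

theorem blochMatrix_mem_masterReachableSet {ω γ κ₁ κ₂ : ℝ} (hω : ω ≠ 0)
    {r₀ r₁ : EuclideanSpace ℝ (Fin 3)} (h : r₁ ∈ blochReachableSet (2 * ω) γ κ₁ κ₂ r₀) :
    blochMatrix r₁ ∈ masterReachableSet ω γ κ₁ κ₂ (blochMatrix r₀) := by
  obtain ⟨T, hT, u₁, u₂, hu₁, hu₂, r, ⟨hrc, hr⟩, r0, rT⟩ := h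
  refine ⟨T, hT, u₁, u₂, hu₁, hu₂, fun t => blochMatrix (r t),
    ⟨continuous_blochMatrix.comp_continuousOn hrc, fun t ht i j => ?_⟩, congrArg _ r0,
    congrArg _ rT⟩
  let entry : EuclideanSpace ℝ (Fin 3) →L[ℝ] ℂ :=
    (Matrix.entryLinearMap ℝ ℂ i j ∘ₗ pauliMatrix).toContinuousLinearMap
  have hentry (v) : pauliMatrix v i j = entry v := rfl
  have hsub : Set.uIcc 0 t ⊆ Set.uIcc 0 T := Set.uIcc_subset_uIcc_left (Set.Icc_subset_uIcc ht)
  have hfield := (intervalIntegrable_blochField (ω := 2 * ω) (γ := γ) (κ₁ := κ₁) (κ₂ := κ₂)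
    hu₁ hu₂ (by rwa [Set.uIcc_of_le hT])).mono_set hsub
  simp only [masterField_blochMatrix hω, hentry]
  rw [entry.intervalIntegral_comp_comm hfield, blochMatrix, blochMatrix, Matrix.add_apply,
    Matrix.add_apply, hentry, hentry, hr t ht, map_add, add_assoc]

theorem exists_eq_blochMatrix {ρ : Matrix (Fin 2) (Fin 2) ℂ} (hρ : ρ.IsHermitian)
    (htr : ρ.trace = 1) : ∃ r, ρ = blochMatrix r := by
  have h00 : ρ 0 0 = (ρ 0 0).re := (hρ.coe_re_apply_self 0).symm
  have h01 : ρ 0 1 = (ρ 0 1).re + (ρ 0 1).im * Complex.I := (Complex.re_add_im _).symm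
  have h10 : ρ 1 0 = (ρ 0 1).re - (ρ 0 1).im * Complex.I := by
    rw [← hρ.apply 1 0]
    exact Complex.ext (by simp) (by simp)
  have h11 : ρ 1 1 = 1 - ρ 0 0 := by rw [← htr, Matrix.trace_fin_two, add_sub_cancel_left]
  obtain ⟨a, b, c, rfl⟩ : ∃ a b c : ℝ,
      ρ = !![(a : ℂ), b + c * Complex.I; b - c * Complex.I, 1 - a] :=
    ⟨(ρ 0 0).re, (ρ 0 1).re, (ρ 0 1).im, by
      rw [← h00, ← h01, ← h10, ← h11]; exact Matrix.eta_fin_two ρ⟩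
  refine ⟨!₂[2 * b, -(2 * c), 2 * a - 1], ?_⟩
  rw [blochMatrix_eq]
  ext i j
  fin_cases i <;> fin_cases j <;> simp <;> ring

theorem det_blochMatrix (r : EuclideanSpace ℝ (Fin 3)) :
    (blochMatrix r).det = (((1 - ‖r‖ ^ 2) / 4 : ℝ) : ℂ) := by
  rw [norm_sq_eq_sum_three, blochMatrix_eq, Matrix.det_fin_two_of]
  push_cast
  linear_combination (r 1 ^ 2 / 4 : ℂ) * Complex.I_sq

theorem mul_self_eq_trace_smul_sub_det_smul {R : Type*} [CommRing R]
    (M : Matrix (Fin 2) (Fin 2) R) : M * M = M.trace • M - M.det • 1 := by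
  rw [Matrix.trace_fin_two, Matrix.det_fin_two]
  ext i j
  fin_cases i <;> fin_cases j <;> simp [Matrix.mul_apply] <;> ring

theorem norm_lt_one_of_not_isPureState {r : EuclideanSpace ℝ (Fin 3)}
    (hr : IsDensityMatrix (blochMatrix r)) (hpure : ¬ IsPureState (blochMatrix r)) :
    ‖r‖ < 1 := by
  have hle : ‖r‖ ^ 2 ≤ 1 := by
    have hdet := hr.1.det_nonneg
    rw [det_blochMatrix, Complex.zero_le_real] at hdet
    linarith
  have hne : ‖r‖ ^ 2 ≠ 1 := by
    intro hone
    refine hpure ⟨hr, ?_⟩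
    rw [mul_self_eq_trace_smul_sub_det_smul, hr.2, det_blochMatrix, hone, sub_self, zero_div,
      Complex.ofReal_zero, zero_smul, sub_zero, one_smul]
  exact (sq_lt_one_iff₀ (norm_nonneg r)).1 (hle.lt_of_ne hne)

end BlochRepresentation

end QubitControl

theorem mainTheorem4_general {ω γ κ₁ κ₂ : ℝ} (hω : ω ≠ 0) (hγ : 0 < γ) (hκ₁ : κ₁ ≠ 0)
    (hκ₂ : κ₂ ≠ 0) :
    (∀ r₀, ∀ r₁ ∈ interior QubitControl.blochBall,
      r₁ ∈ QubitControl.blochReachableSet ω γ κ₁ κ₂ r₀) ∧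
    (∀ ρ₀ ρ₁ : Matrix (Fin 2) (Fin 2) ℂ, ρ₀.IsHermitian → ρ₀.trace = 1 →
      QubitControl.IsDensityMatrix ρ₁ → ¬ QubitControl.IsPureState ρ₁ →
      ρ₁ ∈ QubitControl.masterReachableSet ω γ κ₁ κ₂ ρ₀) := by
  refine ⟨fun r₀ r₁ hr₁ => ?_, fun ρ₀ ρ₁ hρ₀ htr₀ hρ₁ hpure₁ => ?_⟩
  · rw [QubitControl.blochBall, interior_closedBall _ one_ne_zero, mem_ball_zero_iff] at hr₁
    exact QubitControl.mem_blochReachableSet_of_norm_lt_one hω hγ hκ₁ hκ₂ r₀ hr₁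
  · obtain ⟨r₀, rfl⟩ := QubitControl.exists_eq_blochMatrix hρ₀ htr₀
    obtain ⟨r₁, rfl⟩ := QubitControl.exists_eq_blochMatrix hρ₁.1.isHermitian hρ₁.2
    exact QubitControl.blochMatrix_mem_masterReachableSet hω
      (QubitControl.mem_blochReachableSet_of_norm_lt_one (mul_ne_zero two_ne_zero hω) hγ hκ₁ hκ₂
        r₀ (QubitControl.norm_lt_one_of_not_isPureState hρ₁ hpure₁))

theorem mainTheorem4 (ω γ κ₁ κ₂ : ℝ) (hω : 0 < ω) (hγ : 0 < γ) (hκ₁ : 0 < κ₁) (hκ₂ : 0 < κ₂) :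
    (∀ r₀ ∈ interior QubitControl.blochBall, ∀ r₁ ∈ interior QubitControl.blochBall,
      r₁ ∈ QubitControl.blochReachableSet ω γ κ₁ κ₂ r₀) ∧
    (∀ ρ₀ ρ₁ : Matrix (Fin 2) (Fin 2) ℂ,
      QubitControl.IsDensityMatrix ρ₀ → ¬ QubitControl.IsPureState ρ₀ →
      QubitControl.IsDensityMatrix ρ₁ → ¬ QubitControl.IsPureState ρ₁ →
      ρ₁ ∈ QubitControl.masterReachableSet ω γ κ₁ κ₂ ρ₀) := by
  have h := mainTheorem4_general hω.ne' hγ hκ₁.ne' hκ₂.ne'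
  exact ⟨fun r₀ _ => h.1 r₀, fun ρ₀ ρ₁ hρ₀ _ => h.2 ρ₀ ρ₁ hρ₀.1.isHermitian hρ₀.2⟩
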